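/- Let $(M,g)$ be a smooth Lorentzian manifold of signature $(-,+,\dots,+)$ and dimension $n+1\ge 2$, with Levi-Civita connection $\nabla$, and let $f:M\to\mathbb R$ be a spacetime convex function: $f$ is smooth, its Hessian $\nabla_\mu\nabla_\nu f$ has Lorentzian signature $(-,+,\dots,+)$ at every point, and there is a constant $c>0$ with $V^\mu V^\nu\nabla_\mu\nabla_\nu f\ge c\,g_{\mu\nu}V^\mu V^\nu$ for all $V\in TM$. Let $\iota:\Sigma\to M$ be a (possibly only immersed) smooth spacelike hypersurface, i.e. $\dim\Sigma=n$ and the induced metric $h=\iota^*g$ is positive definite, with extrinsic curvature $K_{ij}$ with respect to a unit normal (defined up to sign). If $\Sigma$ is maximal, i.e. $h^{ij}K_{ij}=0$ everywhere on $\Sigma$, then $(\Sigma,h)$ admits a strictly subharmonic function, namely the restriction of $f$: the function $f\circ\iota$ is smooth and $\Delta_h(f\circ\iota)=h^{ij}D_iD_j(f\circ\iota)>0$ everywhere on $\Sigma$, where $D$ is the Levi-Civita connection of $h$. -/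

import Mathlib

set_option maxSynthPendingDepth 3
set_option linter.unusedSectionVars false

open scoped Manifold ContDiff Topology

noncomputable section

namespace SpacetimeConvex

/-! ### Symmetric forms on a single vector space -/

section Forms

variable {V : Type*} [AddCommGroup V] [Module ℝ V] [TopologicalSpace V]
  [IsTopologicalAddGroup V] [ContinuousSMul ℝ V]
  {W : Type*} [AddCommGroup W] [Module ℝ W] [TopologicalSpace W]
  [IsTopologicalAddGroup W] [ContinuousSMul ℝ W]

/-- The bilinear form `B` is symmetric of signature `(-, +, ..., +)`: in a suitable basis
`e 0, ..., e n` its matrix is `diag(-1, 1, ..., 1)`. -/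
def HasLorentzianSignature (B : V →L[ℝ] V →L[ℝ] ℝ) : Prop :=
  ∃ (n : ℕ) (e : Module.Basis (Fin (n + 1)) ℝ V), ∀ i j,
    B (e i) (e j) = if i = j then (if i = 0 then -1 else 1) else 0

/-- The pullback `(u, v) ↦ B (A u) (A v)` of a bilinear form along a linear map. -/
def pullForm (B : V →L[ℝ] V →L[ℝ] ℝ) (A : W →L[ℝ] V) : W →L[ℝ] W →L[ℝ] ℝ :=
  ContinuousLinearMap.precomp ℝ A ∘L B ∘L A

theorem pullForm_apply (B : V →L[ℝ] V →L[ℝ] ℝ) (A : W →L[ℝ] V) (u v : W) :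
    pullForm B A u v = B (A u) (A v) := rfl

/-- The trace `h^{ij} T_{ij}` of a bilinear form `T` with respect to a nondegenerate form `h`:
the trace of the endomorphism `h⁻¹ ∘ T` of `V`, where `h` and `T` are read as maps from `V` to its
dual. -/
def metricTrace (h T : V →L[ℝ] V →L[ℝ] ℝ) : ℝ :=
  LinearMap.trace ℝ V ((h.inverse ∘L T : V →L[ℝ] V) : V →ₗ[ℝ] V)

end Forms

/-! ### The Christoffel symbols on a normed space -/

section Christoffel

variable {E : Type*} [NormedAddCommGroup E] [NormedSpace ℝ E]

/-- The Christoffel symbols of the first kind of the metric `G` at `y`: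
`christoffelLower G y u v w = (D_u G(v, w) + D_v G(u, w) - D_w G(u, v)) / 2`. -/
def christoffelLower (G : E → E →L[ℝ] E →L[ℝ] ℝ) (y : E) : E →L[ℝ] E →L[ℝ] E →L[ℝ] ℝ :=
  let T : E →L[ℝ] E →L[ℝ] E →L[ℝ] ℝ := fderiv ℝ G y
  let T' : E →L[ℝ] E →L[ℝ] E →L[ℝ] ℝ :=
    (ContinuousLinearMap.flipₗᵢ ℝ E E ℝ).toContinuousLinearEquiv.toContinuousLinearMap ∘L T.flip
  (1 / 2 : ℝ) • (T + T.flip - T')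

theorem christoffelLower_apply (G : E → E →L[ℝ] E →L[ℝ] ℝ) (y u v w : E) :
    christoffelLower G y u v w =
      (1 / 2) * (fderiv ℝ G y u v w + fderiv ℝ G y v u w - fderiv ℝ G y w u v) := by
  simp [christoffelLower]

/-- The Christoffel symbols `Γ^k_{ij} u^i v^j` of the metric `G` at `y`, as a vector-valued
bilinear map: the index `w` of `christoffelLower G y u v w` is raised with `G y`. -/
def christoffel (G : E → E →L[ℝ] E →L[ℝ] ℝ) (y : E) : E →L[ℝ] E →L[ℝ] E :=
  (ContinuousLinearMap.compL ℝ E (E →L[ℝ] ℝ) E (G y).inverse) ∘L christoffelLower G y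

theorem christoffel_apply (G : E → E →L[ℝ] E →L[ℝ] ℝ) (y u v : E) :
    christoffel G y u v = (G y).inverse (christoffelLower G y u v) := rfl

end Christoffel

/-! ### Tensor fields on manifolds -/

section Manifolds

variable {E : Type*} [NormedAddCommGroup E] [NormedSpace ℝ E]
  {M : Type*} [TopologicalSpace M] [ChartedSpace E M]
  {F : Type*} [NormedAddCommGroup F] [NormedSpace ℝ F]
  {S : Type*} [TopologicalSpace S] [ChartedSpace F S]

variable (E M) in
/-- A (not necessarily continuous) field of bilinear forms on the tangent spaces of `M`. -/
abbrev BilinearField : Type _ :=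
  ∀ x : M, TangentSpace 𝓘(ℝ, E) x →L[ℝ] TangentSpace 𝓘(ℝ, E) x →L[ℝ] ℝ

variable (E M) in
/-- A smooth Lorentzian metric, of signature `(-, +, ..., +)`, on `M`. -/
structure LorentzianMetric [IsManifold 𝓘(ℝ, E) ∞ M] where
  /-- The metric at a point. -/
  form : BilinearField E M
  contMDiff : ContMDiff 𝓘(ℝ, E) (𝓘(ℝ, E).prod 𝓘(ℝ, E →L[ℝ] E →L[ℝ] ℝ)) ∞
    (fun x ↦ Bundle.TotalSpace.mk' (E →L[ℝ] E →L[ℝ] ℝ)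
      (E := fun x : M ↦ TangentSpace 𝓘(ℝ, E) x →L[ℝ] TangentSpace 𝓘(ℝ, E) x →L[ℝ] ℝ) x (form x))
  signature : ∀ x, HasLorentzianSignature (form x)

/-- The pullback of a field of bilinear forms on `M` along a map `φ : S → M`. -/
def pullback (φ : S → M) (B : BilinearField E M) : BilinearField F S := fun y ↦
  pullForm (B (φ y)) (mfderiv 𝓘(ℝ, F) 𝓘(ℝ, E) φ y)

/-- The differential at `x` of the chart around `x`: it sends a tangent vector at `x` to its
components in this chart. -/
def toChart (x : M) : TangentSpace 𝓘(ℝ, E) x →L[ℝ] E :=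
  (NormedSpace.fromTangentSpace (𝕜 := ℝ) (extChartAt 𝓘(ℝ, E) x x) :
      TangentSpace 𝓘(ℝ, E) (extChartAt 𝓘(ℝ, E) x x) →L[ℝ] E) ∘L
    mfderiv 𝓘(ℝ, E) 𝓘(ℝ, E) (extChartAt 𝓘(ℝ, E) x) x

/-- The components of `B` in the chart around `x`, as a function on the model space: the pullback
of `B` along the inverse of the chart. -/
def inChart (B : BilinearField E M) (x : M) : E → E →L[ℝ] E →L[ℝ] ℝ := fun y ↦
  pullForm (B ((extChartAt 𝓘(ℝ, E) x).symm y))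
    (mfderiv 𝓘(ℝ, E) 𝓘(ℝ, E) (extChartAt 𝓘(ℝ, E) x).symm y ∘L
      ((NormedSpace.fromTangentSpace (𝕜 := ℝ) y).symm : E →L[ℝ] TangentSpace 𝓘(ℝ, E) y))

/-- The Hessian `∇_i ∇_j f = ∂_i ∂_j f - Γ^k_{ij} ∂_k f` of a function `f` with respect to the
Levi-Civita connection of the metric `g`, computed at `x` in the chart around `x`. -/
def hessian (g : BilinearField E M) (f : M → ℝ) : BilinearField E M := fun x ↦
  let φ := extChartAt 𝓘(ℝ, E) x
  let D : E →L[ℝ] E →L[ℝ] ℝ := fderiv ℝ (fderiv ℝ (f ∘ φ.symm)) (φ x)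
    - ContinuousLinearMap.compL ℝ E E ℝ (fderiv ℝ (f ∘ φ.symm) (φ x)) ∘L
        christoffel (inChart g x) (φ x)
  pullForm D (toChart x)

/-- The Laplace-Beltrami operator `Δ_h u = h^{ij} D_i D_j u` of the metric `h`. -/
def laplacian (h : BilinearField F S) (u : S → ℝ) (x : S) : ℝ :=
  metricTrace (h x) (hessian h u x)

/-- A function is strictly subharmonic if it is smooth with everywhere positive Laplacian. -/
def IsStrictlySubharmonic (h : BilinearField F S) (u : S → ℝ) : Prop :=
  ContMDiff 𝓘(ℝ, F) 𝓘(ℝ, ℝ) ∞ u ∧ ∀ x, 0 < laplacian h u x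

/-- A spacetime convex function: a smooth function whose Hessian has Lorentzian signature and
satisfies `V^μ V^ν ∇_μ ∇_ν f ≥ c g_{μν} V^μ V^ν` for all tangent vectors `V`, with a constant
`c > 0`. -/
structure IsSpacetimeConvex (g : BilinearField E M) (f : M → ℝ) : Prop where
  smooth : ContMDiff 𝓘(ℝ, E) 𝓘(ℝ, ℝ) ∞ f
  signature : ∀ x, HasLorentzianSignature (hessian g f x)
  convex : ∃ c : ℝ, 0 < c ∧ ∀ (x : M) (V : TangentSpace 𝓘(ℝ, E) x),
    c * g x V V ≤ hessian g f x V V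

/-- The map `ι : S → M` makes `S` an (immersed) spacelike hypersurface of `M`: it is smooth, of
codimension one, and the induced metric is positive definite (so `ι` is an immersion). -/
structure IsSpacelikeHypersurface (g : BilinearField E M) (ι : S → M) : Prop where
  smooth : ContMDiff 𝓘(ℝ, F) 𝓘(ℝ, E) ∞ ι
  codim_one : Module.finrank ℝ E = Module.finrank ℝ F + 1
  spacelike : ∀ (x : S) (u : TangentSpace 𝓘(ℝ, F) x), u ≠ 0 → 0 < pullback ι g x u u

/-- `ν` is a (timelike) unit normal of the spacelike hypersurface `ι` at the point `x`. -/
def IsUnitNormal (g : BilinearField E M) (ι : S → M) (x : S)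
    (ν : TangentSpace 𝓘(ℝ, E) (ι x)) : Prop :=
  g (ι x) ν ν = -1 ∧
    ∀ u : TangentSpace 𝓘(ℝ, F) x, g (ι x) ν (mfderiv 𝓘(ℝ, F) 𝓘(ℝ, E) ι x u) = 0

/-- The extrinsic curvature (second fundamental form) `K(u, v) = - g(ν, ∇_u v) = g(∇_u ν, v)` of
the hypersurface `ι` at `x` with respect to the unit normal `ν`. In the charts around `x` and
`ι x`, where `ι` is represented by `J` and `ν` by `n`, the covariant derivative along `u` of (an extension of) the
tangent vector `v` is, up to a tangent vector, `∂_u ∂_v J + Γ(∂_u J, ∂_v J)`. -/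
def extrinsicCurvature (g : BilinearField E M) (ι : S → M) (x : S)
    (ν : TangentSpace 𝓘(ℝ, E) (ι x)) :
    TangentSpace 𝓘(ℝ, F) x →L[ℝ] TangentSpace 𝓘(ℝ, F) x →L[ℝ] ℝ :=
  let φ := extChartAt 𝓘(ℝ, F) x
  let ψ := extChartAt 𝓘(ℝ, E) (ι x)
  let J : F → E := ψ ∘ ι ∘ φ.symm
  let A : F →L[ℝ] E := fderiv ℝ J (φ x)
  let n : E := toChart (ι x) ν
  let W : F →L[ℝ] F →L[ℝ] E := fderiv ℝ (fderiv ℝ J) (φ x)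
    + (christoffel (inChart g (ι x)) (ψ (ι x))).bilinearComp A A
  let K : F →L[ℝ] F →L[ℝ] ℝ :=
    - ContinuousLinearMap.compL ℝ F E ℝ (inChart g (ι x) (ψ (ι x)) n) ∘L W
  pullForm K (toChart x)

/-- The hypersurface `ι` is maximal: `h^{ij} K_{ij} = 0` at every point. The two unit normals at a
point give opposite values of `K`, so the choice of normal does not matter. -/
def IsMaximal (g : BilinearField E M) (ι : S → M) : Prop :=
  ∀ (x : S) (ν : TangentSpace 𝓘(ℝ, E) (ι x)), IsUnitNormal (F := F) g ι x ν →
    metricTrace (pullback (F := F) ι g x) (extrinsicCurvature g ι x ν) = 0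

end Manifolds

end SpacetimeConvex

end

/-! Let `J` represent `ι` in charts, with derivative `A` and unit normal `n`. The chain rule shows
that the Hessian of `f ∘ ι` for the induced metric and the pullback of the Hessian of `f` differ by
`df` applied to `J'' + Γ_G(A, A) - A Γ_H`. By the Gauss formula (`gauss_formula`) this vector is
normal, hence a multiple of `n`, and the coefficient is the extrinsic curvature. So `D_i D_j (f ∘ ι)
= (ι^* ∇∇f)_{ij} + (∂_n f) K_{ij}` (`hessian_comp_apply`).

Tracing with `h` gives `laplacian_comp`. Maximality kills the `K` term, and convexity on tangent
vectors of the hypersurface bounds the remaining trace below by `c * dim F > 0` (`le_metricTrace`).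
-/

namespace SpacetimeConvex

/-! ### Lorentzian forms, traces and spacelike hyperplanes. -/

section LinearAlgebra

variable {V : Type*} [NormedAddCommGroup V] [NormedSpace ℝ V] [FiniteDimensional ℝ V]
  {W : Type*} [NormedAddCommGroup W] [NormedSpace ℝ W] [FiniteDimensional ℝ W]

theorem HasLorentzianSignature.symm {B : V →L[ℝ] V →L[ℝ] ℝ} (hB : HasLorentzianSignature B)
    (u v : V) : B u v = B v u := by
  obtain ⟨n, e, he⟩ := hB
  have h : (B.toLinearMap₁₂ : V →ₗ[ℝ] V →ₗ[ℝ] ℝ) = B.toLinearMap₁₂.flip := by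
    refine e.ext fun i ↦ e.ext fun j ↦ ?_
    change B (e i) (e j) = B (e j) (e i)
    by_cases hij : i = j
    · simp [hij]
    · simp [he, hij, Ne.symm hij]
  simpa using LinearMap.congr_fun₂ h u v

theorem HasLorentzianSignature.nondegenerate {B : V →L[ℝ] V →L[ℝ] ℝ}
    (hB : HasLorentzianSignature B) {u : V} (hu : ∀ v, B u v = 0) : u = 0 := by
  obtain ⟨n, e, he⟩ := hB
  refine e.ext_elem fun j ↦ ?_
  have h := hu (e j)
  rw [← e.sum_repr u] at h
  simp only [map_sum, map_smul, sum_apply, smul_apply, he,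
    smul_eq_mul, mul_ite, mul_zero, Finset.sum_ite_eq', Finset.mem_univ, if_true] at h
  by_cases hj : j = 0
  · simpa [hj] using h
  · simpa [hj] using h

theorem HasLorentzianSignature.exists_neg {B : V →L[ℝ] V →L[ℝ] ℝ}
    (hB : HasLorentzianSignature B) : ∃ u, B u u < 0 := by
  obtain ⟨n, e, he⟩ := hB
  exact ⟨e 0, by simp [he]⟩

/-- A form without kernel on a finite-dimensional space identifies the space with its dual. -/
theorem isInvertible_of_nondegenerate {B : V →L[ℝ] V →L[ℝ] ℝ}
    (hB : ∀ u, (∀ v, B u v = 0) → u = 0) : B.IsInvertible := by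
  have hinj : Function.Injective (B : V →ₗ[ℝ] V →L[ℝ] ℝ) := by
    rw [← LinearMap.ker_eq_bot, LinearMap.ker_eq_bot']
    intro u hu
    exact hB u fun v ↦ by simpa using congrArg (fun l : V →L[ℝ] ℝ ↦ l v) hu
  have hdim : Module.finrank ℝ V = Module.finrank ℝ (V →L[ℝ] ℝ) := by
    rw [← (LinearMap.toContinuousLinearMap (𝕜 := ℝ) (E := V) (F' := ℝ)).finrank_eq]
    exact (Subspace.dual_finrank_eq).symm
  exact ⟨(LinearEquiv.ofInjectiveOfFinrankEq (B : V →ₗ[ℝ] V →L[ℝ] ℝ) hinj hdim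
    ).toContinuousLinearEquiv, by ext; rfl⟩

theorem IsInvertible.apply_inverse {B : V →L[ℝ] V →L[ℝ] ℝ} (hB : B.IsInvertible)
    (l : V →L[ℝ] ℝ) : B (B.inverse l) = l := by
  obtain ⟨e, rfl⟩ := hB
  simp

theorem metricTrace_add_smul (h T T' : V →L[ℝ] V →L[ℝ] ℝ) (c : ℝ) :
    metricTrace h (T + c • T') = metricTrace h T + c * metricTrace h T' := by
  simp [metricTrace]

/-- If `T ≥ c h` on the diagonal, with `h` positive definite, then `h^{ij} T_{ij} ≥ c dim V`. -/
theorem le_metricTrace {h T : V →L[ℝ] V →L[ℝ] ℝ} (hsymm : ∀ u v, h u v = h v u)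
    (hpos : ∀ u, u ≠ 0 → 0 < h u u) {c : ℝ} (hT : ∀ u, c * h u u ≤ T u u) :
    c * Module.finrank ℝ V ≤ metricTrace h T := by
  have hinv : h.IsInvertible := isInvertible_of_nondegenerate fun u hu ↦ by
    by_contra h0
    exact (hpos u h0).ne' (hu u)
  -- In an `h`-orthogonal basis the diagonal entries of `h⁻¹ T` are `T (e i) (e i) / h (e i) (e i)`,
  -- each at least `c`; no normalization is needed.
  obtain ⟨e, he⟩ := LinearMap.BilinForm.exists_orthogonal_basis (B := h.toLinearMap₁₂)
    ⟨fun u v ↦ by simp [hsymm u v]⟩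
  have hee : ∀ i j, i ≠ j → h (e i) (e j) = 0 := fun i j hij ↦ by simpa using he hij
  have hrepr : ∀ x i, h x (e i) = e.repr x i * h (e i) (e i) := fun x i ↦ by
    conv_lhs => rw [← e.sum_repr x]
    simp only [map_sum, map_smul, sum_apply, smul_apply,
      smul_eq_mul]
    exact Finset.sum_eq_single i (fun j _ hj ↦ by rw [hee j i hj, mul_zero]) (by simp)
  rw [metricTrace, LinearMap.trace_eq_matrix_trace ℝ e, Matrix.trace]
  have : c * Module.finrank ℝ V = ∑ _i : Fin (Module.finrank ℝ V), c := by simp [mul_comm]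
  rw [this]
  refine Finset.sum_le_sum fun i _ ↦ ?_
  have hi := hpos (e i) (e.ne_zero i)
  have h1 := hrepr (h.inverse (T (e i))) i
  rw [IsInvertible.apply_inverse hinv] at h1
  have h2 := hT (e i)
  rw [h1] at h2
  simpa [LinearMap.toMatrix_apply] using le_of_mul_le_mul_right h2 hi

section Hyperplane

variable {B : V →L[ℝ] V →L[ℝ] ℝ} {A : W →L[ℝ] V}

/-- A hyperplane on which `B` is positive definite, together with a nonzero normal, spans. -/
theorem exists_eq_add_smul_normal (hdim : Module.finrank ℝ V = Module.finrank ℝ W + 1)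
    (hpos : ∀ u, u ≠ 0 → 0 < B (A u) (A u)) {n : V} (hn0 : n ≠ 0)
    (hn : ∀ u, B (A u) n = 0) (x : V) :
    ∃ (u : W) (t : ℝ), x = A u + t • n := by
  let L : W × ℝ →ₗ[ℝ] V :=
    (A : W →ₗ[ℝ] V).coprod (LinearMap.toSpanSingleton ℝ V n)
  have hL : ∀ p, L p = A p.1 + p.2 • n := fun p ↦ by simp [L]
  have hinj : Function.Injective L := by
    rw [← LinearMap.ker_eq_bot, LinearMap.ker_eq_bot']
    rintro ⟨u, t⟩ h
    rw [hL] at h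
    have hu : u = 0 := by
      by_contra hu
      -- Pairing with `A u` removes the normal part and leaves `B (A u) (A u) = 0`.
      have h1 := congrArg (fun y ↦ B (A u) y) h
      simp [hn] at h1
      exact (hpos u hu).ne' h1
    subst hu
    have ht : t = 0 := by simpa [hn0] using h
    rw [ht]; rfl
  have hsurj : Function.Surjective L := by
    rw [← LinearMap.injective_iff_surjective_of_finrank_eq_finrank]
    · exact hinj
    · simp [hdim]
  obtain ⟨p, hp⟩ := hsurj x
  exact ⟨p.1, p.2, by rw [← hp, hL]⟩

/-- A spacelike hyperplane of a Lorentzian vector space has a timelike unit normal. -/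
theorem exists_unit_normal (hB : HasLorentzianSignature B)
    (hdim : Module.finrank ℝ V = Module.finrank ℝ W + 1)
    (hpos : ∀ u, u ≠ 0 → 0 < B (A u) (A u)) :
    ∃ n : V, B n n = -1 ∧ ∀ u, B n (A u) = 0 := by
  let L : V →ₗ[ℝ] Module.Dual ℝ W :=
    B.toLinearMap₁₂.compl₂ (A : W →ₗ[ℝ] V)
  have hL : ∀ x u, L x u = B x (A u) := fun x u ↦ by simp [L]
  have hker : LinearMap.ker L ≠ ⊥ := by
    apply LinearMap.ker_ne_bot_of_finrank_lt
    rw [Subspace.dual_finrank_eq, hdim]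
    exact Nat.lt_succ_self _
  obtain ⟨m, hm, hm0⟩ := (Submodule.ne_bot_iff _).1 hker
  have hmA : ∀ u, B m (A u) = 0 := fun u ↦ by
    rw [← hL, LinearMap.mem_ker.1 hm, LinearMap.zero_apply]
  have hmm : B m m < 0 := by
    -- If `B m m ≥ 0`, the orthogonal splitting along `m` makes `B` positive semidefinite, against
    -- the existence of a timelike vector.
    by_contra! hmm
    obtain ⟨x, hx⟩ := hB.exists_neg
    obtain ⟨u, t, rfl⟩ := exists_eq_add_smul_normal hdim hpos hm0
      (fun u ↦ (hB.symm _ _).trans (hmA u)) x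
    have h1 : 0 ≤ B (A u) (A u) := by
      by_cases hu : u = 0
      · simp [hu]
      · exact (hpos u hu).le
    have h2 : B (A u + t • m) (A u + t • m) = B (A u) (A u) + t * t * B m m := by
      simp [hmA, hB.symm (A u) m]; ring
    rw [h2] at hx
    nlinarith [mul_nonneg (mul_self_nonneg t) hmm]
  refine ⟨(√(-B m m))⁻¹ • m, ?_, fun u ↦ by simp [hmA]⟩
  have h0 : 0 < -B m m := by linarith
  have h1 : √(-B m m) * √(-B m m) = -B m m := Real.mul_self_sqrt h0.le
  have h2 : √(-B m m) ≠ 0 := (Real.sqrt_pos.2 h0).ne'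
  simp only [map_smul, smul_apply, smul_eq_mul]
  field_simp
  rw [sq]; linarith

/-- A vector orthogonal to a spacelike hyperplane is a multiple of the unit normal. -/
theorem eq_smul_normal_of_orthogonal (hB : HasLorentzianSignature B)
    (hdim : Module.finrank ℝ V = Module.finrank ℝ W + 1)
    (hpos : ∀ u, u ≠ 0 → 0 < B (A u) (A u)) {n : V} (hnn : B n n = -1)
    (hn : ∀ u, B n (A u) = 0) {x : V} (hx : ∀ u, B x (A u) = 0) : x = (-B n x) • n := by
  have hn' : ∀ u, B (A u) n = 0 := fun u ↦ (hB.symm _ _).trans (hn u)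
  have hn0 : n ≠ 0 := by rintro rfl; simp at hnn
  obtain ⟨u, t, rfl⟩ := exists_eq_add_smul_normal hdim hpos hn0 hn' x
  have hu : u = 0 := by
    by_contra hu
    have h1 := hx u
    simp [hn] at h1
    exact (hpos u hu).ne' h1
  simp [hu, hnn]

end Hyperplane

end LinearAlgebra


/-! ### Second derivatives and Christoffel symbols in coordinates. -/

section LocalGeometry

variable {E : Type*} [NormedAddCommGroup E] [NormedSpace ℝ E] [FiniteDimensional ℝ E]
  {F : Type*} [NormedAddCommGroup F] [NormedSpace ℝ F] [FiniteDimensional ℝ F]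

theorem apply_christoffel {G : E → E →L[ℝ] E →L[ℝ] ℝ} {y : E} (hG : (G y).IsInvertible)
    (u v w : E) : G y (christoffel G y u v) w = christoffelLower G y u v w := by
  rw [christoffel_apply, IsInvertible.apply_inverse hG]

theorem differentiableAt_fderiv {J : F → E} {a : F} (hJ : ContDiffAt ℝ 2 J a) :
    DifferentiableAt ℝ (fderiv ℝ J) a :=
  (hJ.fderiv_right (m := 1) (by norm_num)).differentiableAt (by norm_num)

/-- Leibniz rule: one term from the metric and one from each of the two slots. -/
theorem fderiv_pullForm_apply {G : E → E →L[ℝ] E →L[ℝ] ℝ} {J : F → E} {a : F}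
    (hG : DifferentiableAt ℝ G (J a)) (hJ : ContDiffAt ℝ 2 J a) (u v w : F) :
    fderiv ℝ (fun y ↦ pullForm (G (J y)) (fderiv ℝ J y)) a u v w =
      fderiv ℝ G (J a) (fderiv ℝ J a u) (fderiv ℝ J a v) (fderiv ℝ J a w)
      + G (J a) (fderiv ℝ (fderiv ℝ J) a u v) (fderiv ℝ J a w)
      + G (J a) (fderiv ℝ J a v) (fderiv ℝ (fderiv ℝ J) a u w) := by
  have hJ1 : HasFDerivAt J (fderiv ℝ J a) a := (hJ.differentiableAt (by norm_num)).hasFDerivAt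
  have hJ2 := (differentiableAt_fderiv hJ).hasFDerivAt
  have hGJ : HasFDerivAt (fun y ↦ G (J y)) (fderiv ℝ G (J a) ∘L fderiv ℝ J a) a :=
    hG.hasFDerivAt.comp a hJ1
  -- Precomposition with `fderiv ℝ J y` is linear in `fderiv ℝ J y`, so `pullForm` becomes a
  -- composition of differentiable families of linear maps.
  have hP : HasFDerivAt (fun y ↦ (ContinuousLinearMap.compL ℝ F E ℝ).flip (fderiv ℝ J y))
      ((ContinuousLinearMap.compL ℝ F E ℝ).flip ∘L fderiv ℝ (fderiv ℝ J) a) a :=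
    (ContinuousLinearMap.compL ℝ F E ℝ).flip.hasFDerivAt.comp a hJ2
  have h := hP.clm_comp (hGJ.clm_comp hJ2)
  have h' : HasFDerivAt (fun y ↦ pullForm (G (J y)) (fderiv ℝ J y)) _ a := h
  rw [h'.fderiv]
  simp
  ring

/-- The Gauss formula: the difference between the covariant derivative of the ambient metric `G`
and that of the induced metric `H` is normal. -/
theorem gauss_formula {G : E → E →L[ℝ] E →L[ℝ] ℝ} {J : F → E} {H : F → F →L[ℝ] F →L[ℝ] ℝ} {a : F}
    (hG : DifferentiableAt ℝ G (J a)) (hsymm : ∀ u v, G (J a) u v = G (J a) v u)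
    (hGinv : (G (J a)).IsInvertible) (hJ : ContDiffAt ℝ 2 J a)
    (hH : H =ᶠ[𝓝 a] fun y ↦ pullForm (G (J y)) (fderiv ℝ J y)) (hHinv : (H a).IsInvertible)
    (v w z : F) :
    G (J a) (fderiv ℝ (fderiv ℝ J) a v w
      + christoffel G (J a) (fderiv ℝ J a v) (fderiv ℝ J a w)
      - fderiv ℝ J a (christoffel H a v w)) (fderiv ℝ J a z) = 0 := by
  have hJsymm : ∀ u v, fderiv ℝ (fderiv ℝ J) a u v = fderiv ℝ (fderiv ℝ J) a v u :=
    hJ.isSymmSndFDerivAt (by simp)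
  have h1 : G (J a) (fderiv ℝ J a (christoffel H a v w)) (fderiv ℝ J a z) =
      christoffelLower H a v w z := by
    rw [← apply_christoffel hHinv, hH.eq_of_nhds, pullForm_apply]
  -- In the expansion of `christoffelLower H` the terms in `fderiv ℝ G` match the ambient symbol. Of
  -- the six terms in `J''`, symmetry cancels four and leaves two copies of `G (J'' v w) (A z)`,
  -- absorbed by the factor `1 / 2`.
  simp only [map_add, map_sub, add_apply, sub_apply, h1, apply_christoffel hGinv,
    christoffelLower_apply, hH.fderiv_eq, fderiv_pullForm_apply hG hJ]
  rw [hJsymm w v, hJsymm z v, hJsymm z w, hsymm (fderiv ℝ J a w),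
    hsymm (fderiv ℝ (fderiv ℝ J) a v z)]
  ring

theorem fderiv_fderiv_comp_apply {f : E → ℝ} {J : F → E} {a : F}
    (hf : ContDiffAt ℝ 2 f (J a)) (hJ : ContDiffAt ℝ 2 J a) (v w : F) :
    fderiv ℝ (fderiv ℝ (f ∘ J)) a v w =
      fderiv ℝ (fderiv ℝ f) (J a) (fderiv ℝ J a v) (fderiv ℝ J a w)
      + fderiv ℝ f (J a) (fderiv ℝ (fderiv ℝ J) a v w) := by
  have hf1 : ∀ᶠ y in 𝓝 (J a), DifferentiableAt ℝ f y :=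
    (hf.eventually (by norm_num)).mono fun y hy ↦ hy.differentiableAt (by norm_num)
  have hJ1 : ∀ᶠ y in 𝓝 a, DifferentiableAt ℝ J y :=
    (hJ.eventually (by norm_num)).mono fun y hy ↦ hy.differentiableAt (by norm_num)
  have heq : fderiv ℝ (f ∘ J) =ᶠ[𝓝 a] fun y ↦ fderiv ℝ f (J y) ∘L fderiv ℝ J y := by
    filter_upwards [hJ.continuousAt.eventually hf1, hJ1] with y hy hy'
    exact fderiv_comp y hy hy'
  have h1 : HasFDerivAt (fun y ↦ fderiv ℝ f (J y))
      (fderiv ℝ (fderiv ℝ f) (J a) ∘L fderiv ℝ J a) a :=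
    (differentiableAt_fderiv hf).hasFDerivAt.comp a hJ1.self_of_nhds.hasFDerivAt
  rw [heq.fderiv_eq, (h1.clm_comp (differentiableAt_fderiv hJ).hasFDerivAt).fderiv]
  simp
  ring

end LocalGeometry


/-! ### Coordinate representations of maps, forms and metrics. -/

section Charts

variable {E : Type*} [NormedAddCommGroup E] [NormedSpace ℝ E]
  {M : Type*} [TopologicalSpace M] [ChartedSpace E M] [IsManifold 𝓘(ℝ, E) ∞ M]
  {F : Type*} [NormedAddCommGroup F] [NormedSpace ℝ F]
  {S : Type*} [TopologicalSpace S] [ChartedSpace F S] [IsManifold 𝓘(ℝ, F) ∞ S]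

theorem mdifferentiableAt_chart_symm (x : M) {y : E} (hy : y ∈ (extChartAt 𝓘(ℝ, E) x).target) :
    MDifferentiableAt 𝓘(ℝ, E) 𝓘(ℝ, E) (extChartAt 𝓘(ℝ, E) x).symm y := by
  have : IsManifold 𝓘(ℝ, E) 1 M := IsManifold.of_le (n := ∞) (by norm_num)
  have h := mdifferentiableWithinAt_extChartAt_symm (I := 𝓘(ℝ, E)) hy
  rwa [modelWithCornersSelf_coe, Set.range_id, mdifferentiableWithinAt_univ] at h

theorem mdifferentiableAt_chart (x : M) {y : M} (hy : y ∈ (extChartAt 𝓘(ℝ, E) x).source) :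
    MDifferentiableAt 𝓘(ℝ, E) 𝓘(ℝ, E) (extChartAt 𝓘(ℝ, E) x) y := by
  have : IsManifold 𝓘(ℝ, E) 1 M := IsManifold.of_le (n := ∞) (by norm_num)
  exact mdifferentiableAt_extChartAt (by simpa using hy)

/-- The differential of the inverse chart is inverse to `toChart`. -/
theorem mfderiv_chart_symm_toChart (x : M) (u : TangentSpace 𝓘(ℝ, E) x) :
    let L : E →L[ℝ] E :=
      mfderiv 𝓘(ℝ, E) 𝓘(ℝ, E) (extChartAt 𝓘(ℝ, E) x).symm (extChartAt 𝓘(ℝ, E) x x)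
    L (toChart x u) = u := by
  have : IsManifold 𝓘(ℝ, E) 1 M := IsManifold.of_le (n := ∞) (by norm_num)
  have h := mfderivWithin_extChartAt_symm_comp_mfderiv_extChartAt' (I := 𝓘(ℝ, E))
    (mem_extChartAt_source (I := 𝓘(ℝ, E)) x)
  simp only [modelWithCornersSelf_coe, Set.range_id, mfderivWithin_univ] at h
  exact congrArg (fun L : E →L[ℝ] E ↦ L u) h

theorem inChart_toChart (B : BilinearField E M) (x : M) (u v : TangentSpace 𝓘(ℝ, E) x) :
    inChart B x (extChartAt 𝓘(ℝ, E) x x) (toChart x u) (toChart x v) = B x u v := by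
  -- All tangent spaces are definitionally `E`; forgetting the dependence on the point allows the
  -- base point to be rewritten.
  let B' : M → E → E → ℝ := fun x u v ↦ B x u v
  let L : E →L[ℝ] E :=
    mfderiv 𝓘(ℝ, E) 𝓘(ℝ, E) (extChartAt 𝓘(ℝ, E) x).symm (extChartAt 𝓘(ℝ, E) x x)
  change B' ((extChartAt 𝓘(ℝ, E) x).symm (extChartAt 𝓘(ℝ, E) x x)) (L (toChart x u))
    (L (toChart x v)) = B' x u v
  rw [extChartAt_to_inv]
  exact congrArg₂ (B' x) (mfderiv_chart_symm_toChart x u) (mfderiv_chart_symm_toChart x v)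

theorem toChart_surjective (x : M) : Function.Surjective (toChart (E := E) x) := by
  have : IsManifold 𝓘(ℝ, E) 1 M := IsManifold.of_le (n := ∞) (by norm_num)
  have h := mfderiv_extChartAt_comp_mfderivWithin_extChartAt_symm' (I := 𝓘(ℝ, E))
    (mem_extChartAt_source (I := 𝓘(ℝ, E)) x)
  simp only [modelWithCornersSelf_coe, Set.range_id, mfderivWithin_univ] at h
  intro w
  exact ⟨_, congrArg (fun L : E →L[ℝ] E ↦ L w) h⟩

variable {ι : S → M}

/-- Near the centre of the chart, `ι` is the composition of its coordinate representation with the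
inverse chart. -/
theorem eventually_chart (hι : Continuous ι) (x : S) :
    ∀ᶠ y in 𝓝 (extChartAt 𝓘(ℝ, F) x x), y ∈ (extChartAt 𝓘(ℝ, F) x).target ∧
      ι ((extChartAt 𝓘(ℝ, F) x).symm y) ∈ (extChartAt 𝓘(ℝ, E) (ι x)).source := by
  refine Filter.Eventually.and (extChartAt_target_mem_nhds (I := 𝓘(ℝ, F)) x) ?_
  have h1 : ContinuousAt (fun y ↦ ι ((extChartAt 𝓘(ℝ, F) x).symm y))
      (extChartAt 𝓘(ℝ, F) x x) :=
    hι.continuousAt.comp (continuousAt_extChartAt_symm (I := 𝓘(ℝ, F)) x)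
  apply h1.eventually
  change _ ∈ 𝓝 (ι ((extChartAt 𝓘(ℝ, F) x).symm (extChartAt 𝓘(ℝ, F) x x)))
  rw [extChartAt_to_inv]
  exact extChartAt_source_mem_nhds (I := 𝓘(ℝ, E)) (ι x)

theorem contDiffAt_chart (hι : ContMDiff 𝓘(ℝ, F) 𝓘(ℝ, E) ∞ ι) (x : S) :
    ContDiffAt ℝ 2 (extChartAt 𝓘(ℝ, E) (ι x) ∘ ι ∘ (extChartAt 𝓘(ℝ, F) x).symm)
      (extChartAt 𝓘(ℝ, F) x x) := by
  have h := (contMDiffAt_iff.1 (hι x)).2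
  simp only [modelWithCornersSelf_coe, Set.range_id, contDiffWithinAt_univ] at h
  exact h.of_le ENat.LEInfty.out

theorem contDiffAt_comp_chart_symm {f : M → ℝ} (hf : ContMDiff 𝓘(ℝ, E) 𝓘(ℝ, ℝ) ∞ f) (x : M) :
    ContDiffAt ℝ 2 (f ∘ (extChartAt 𝓘(ℝ, E) x).symm) (extChartAt 𝓘(ℝ, E) x x) := by
  exact contDiffAt_chart hf x

/-- The differential of `ι` is represented in the charts by the derivative of its coordinate
representation. -/
theorem toChart_mfderiv (hι : ContMDiff 𝓘(ℝ, F) 𝓘(ℝ, E) ∞ ι) (x : S)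
    (u : TangentSpace 𝓘(ℝ, F) x) :
    toChart (ι x) (mfderiv 𝓘(ℝ, F) 𝓘(ℝ, E) ι x u) =
      fderiv ℝ (extChartAt 𝓘(ℝ, E) (ι x) ∘ ι ∘ (extChartAt 𝓘(ℝ, F) x).symm)
        (extChartAt 𝓘(ℝ, F) x x) (toChart x u) := by
  have h1 : HasMFDerivAt 𝓘(ℝ, F) 𝓘(ℝ, E) (extChartAt 𝓘(ℝ, E) (ι x) ∘ ι) x _ :=
    (mdifferentiableAt_chart (ι x) (mem_extChartAt_source _)).hasMFDerivAt.comp x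
      ((hι x).mdifferentiableAt (by norm_num)).hasMFDerivAt
  have h2 : HasMFDerivAt 𝓘(ℝ, F) 𝓘(ℝ, E)
      ((extChartAt 𝓘(ℝ, E) (ι x) ∘ ι ∘ (extChartAt 𝓘(ℝ, F) x).symm) ∘ extChartAt 𝓘(ℝ, F) x) x _ :=
    (((contDiffAt_chart hι x).differentiableAt (by norm_num)).hasFDerivAt.hasMFDerivAt).comp x
      (mdifferentiableAt_chart x (mem_extChartAt_source x)).hasMFDerivAt
  have h3 : extChartAt 𝓘(ℝ, E) (ι x) ∘ ι =ᶠ[𝓝 x]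
      (extChartAt 𝓘(ℝ, E) (ι x) ∘ ι ∘ (extChartAt 𝓘(ℝ, F) x).symm) ∘ extChartAt 𝓘(ℝ, F) x := by
    filter_upwards [extChartAt_source_mem_nhds (I := 𝓘(ℝ, F)) x] with y hy
    exact congrArg (extChartAt 𝓘(ℝ, E) (ι x) ∘ ι) ((extChartAt 𝓘(ℝ, F) x).left_inv hy).symm
  exact congrArg (fun L : F →L[ℝ] E ↦ L u) (hasMFDerivAt_unique h1 (h2.congr_of_eventuallyEq h3))

/-- Both sides come from the chain rule for `ι ∘ φ.symm = ψ.symm ∘ J`. Equality on a neighbourhood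
is needed because the Christoffel symbols differentiate the induced metric. -/
theorem inChart_pullback (hι : ContMDiff 𝓘(ℝ, F) 𝓘(ℝ, E) ∞ ι) (B : BilinearField E M) (x : S) :
    inChart (pullback (F := F) ι B) x =ᶠ[𝓝 (extChartAt 𝓘(ℝ, F) x x)] fun y ↦
      pullForm (inChart B (ι x)
          ((extChartAt 𝓘(ℝ, E) (ι x) ∘ ι ∘ (extChartAt 𝓘(ℝ, F) x).symm) y))
        (fderiv ℝ (extChartAt 𝓘(ℝ, E) (ι x) ∘ ι ∘ (extChartAt 𝓘(ℝ, F) x).symm) y) := by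
  have hC : ∀ᶠ y in 𝓝 (extChartAt 𝓘(ℝ, F) x x), DifferentiableAt ℝ
      (extChartAt 𝓘(ℝ, E) (ι x) ∘ ι ∘ (extChartAt 𝓘(ℝ, F) x).symm) y :=
    ((contDiffAt_chart hι x).eventually (by norm_num)).mono
      fun y hy ↦ hy.differentiableAt (by norm_num)
  have hev := eventually_chart (E := E) (F := F) hι.continuous x
  filter_upwards [hC, hev, hev.eventually_nhds] with y hy hy' hy''
  set φ := extChartAt 𝓘(ℝ, F) x
  set ψ := extChartAt 𝓘(ℝ, E) (ι x)
  set J := ψ ∘ ι ∘ φ.symm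
  have hJ : ψ.symm (J y) = ι (φ.symm y) := ψ.left_inv hy'.2
  have h1 : HasMFDerivAt 𝓘(ℝ, F) 𝓘(ℝ, E) (ι ∘ φ.symm) y _ :=
    ((hι (φ.symm y)).mdifferentiableAt (by norm_num)).hasMFDerivAt.comp y
      (mdifferentiableAt_chart_symm x hy'.1).hasMFDerivAt
  have h2 : HasMFDerivAt 𝓘(ℝ, F) 𝓘(ℝ, E) (ψ.symm ∘ J) y _ :=
    (mdifferentiableAt_chart_symm (ι x) (ψ.map_source hy'.2)).hasMFDerivAt.comp y
      hy.hasFDerivAt.hasMFDerivAt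
  have h3 : ι ∘ φ.symm =ᶠ[𝓝 y] ψ.symm ∘ J :=
    hy''.mono fun z hz ↦ (ψ.left_inv hz.2).symm
  have h4 := hasMFDerivAt_unique h1 (h2.congr_of_eventuallyEq h3)
  let B' : M → E → E → ℝ := fun x u v ↦ B x u v
  let L : F → E := mfderiv 𝓘(ℝ, F) 𝓘(ℝ, E) ι (φ.symm y) ∘ mfderiv 𝓘(ℝ, F) 𝓘(ℝ, F) φ.symm y
  let L' : F → E := mfderiv 𝓘(ℝ, E) 𝓘(ℝ, E) ψ.symm (J y) ∘ fderiv ℝ J y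
  have h5 : ∀ u, L u = L' u := fun u ↦ congrArg (fun L : F →L[ℝ] E ↦ L u) h4
  ext u v
  change B' (ι (φ.symm y)) (L u) (L v) = B' (ψ.symm (J y)) (L' u) (L' v)
  rw [h5, h5, hJ]

theorem comp_chart_symm_eventuallyEq (hι : Continuous ι) (f : M → ℝ) (x : S) :
    (f ∘ ι) ∘ (extChartAt 𝓘(ℝ, F) x).symm =ᶠ[𝓝 (extChartAt 𝓘(ℝ, F) x x)]
      (f ∘ (extChartAt 𝓘(ℝ, E) (ι x)).symm) ∘
        (extChartAt 𝓘(ℝ, E) (ι x) ∘ ι ∘ (extChartAt 𝓘(ℝ, F) x).symm) := by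
  filter_upwards [eventually_chart (E := E) (F := F) hι x] with y hy
  exact congrArg f ((extChartAt 𝓘(ℝ, E) (ι x)).left_inv hy.2).symm

/-- The components of a smooth metric in a chart are smooth. -/
theorem differentiableAt_inChart [FiniteDimensional ℝ E] (g : LorentzianMetric E M) (x : M) :
    DifferentiableAt ℝ (inChart g.form x) (extChartAt 𝓘(ℝ, E) x x) := by
  set φ := extChartAt 𝓘(ℝ, E) x
  have hs : IsOpen φ.target := isOpen_extChartAt_target x
  have hT := (contMDiffOn_extChartAt_symm (I := 𝓘(ℝ, E)) (n := ∞) x).contMDiffOn_tangentMapWithin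
    (m := ∞) le_rfl hs.uniqueMDiffOn
  -- The coordinate vector fields are smooth sections along the inverse chart; evaluating the metric
  -- on two of them gives its components.
  have hsec : ∀ u : E, ContMDiffOn 𝓘(ℝ, E) (𝓘(ℝ, E).prod 𝓘(ℝ, E)) ∞
      (fun y ↦ Bundle.TotalSpace.mk' E (E := TangentSpace 𝓘(ℝ, E)) (φ.symm y)
        (mfderiv 𝓘(ℝ, E) 𝓘(ℝ, E) φ.symm y u)) φ.target := by
    intro u
    have h0 : ContMDiff 𝓘(ℝ, E) (𝓘(ℝ, E).prod 𝓘(ℝ, E)) ∞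
        (fun y : E ↦ Bundle.TotalSpace.mk' E (E := TangentSpace 𝓘(ℝ, E)) y (u : E)) := by
      exact contMDiff_vectorSpace_iff_contDiff.2 contDiff_const
    refine (hT.comp h0.contMDiffOn (s := φ.target) fun y hy ↦ hy).congr fun y hy ↦ ?_
    simp only [Function.comp_apply, tangentMapWithin, mfderivWithin_of_isOpen hs hy, φ]
  have hsc : ∀ u v : E, ContDiffOn ℝ ∞ (fun y ↦ inChart g.form x y u v) φ.target := by
    intro u v
    have h := ContMDiffOn.clm_bundle_apply₂ (F₁ := E) (F₂ := E) (F₃ := ℝ)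
      (E₃ := Bundle.Trivial M ℝ) (b := φ.symm)
      (g.contMDiff.comp_contMDiffOn (contMDiffOn_extChartAt_symm (I := 𝓘(ℝ, E)) x))
      (hsec u) (hsec v)
    intro y hy
    have h' := h y hy
    rw [Bundle.contMDiffWithinAt_totalSpace] at h'
    exact h'.2.contDiffWithinAt
  have h : ContDiffOn ℝ ∞ (inChart g.form x) φ.target := by
    -- In finite dimension, smoothness of a form-valued map can be tested on fixed vectors.
    rw [contDiffOn_clm_apply]
    intro u
    rw [contDiffOn_clm_apply]
    exact hsc u
  exact (h.contDiffAt (extChartAt_target_mem_nhds x)).differentiableAt (by norm_num)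

end Charts


/-! ### Hessian and Laplacian of a restricted function. -/

section Hypersurface

variable {E : Type*} [NormedAddCommGroup E] [NormedSpace ℝ E] [FiniteDimensional ℝ E]
  {M : Type*} [TopologicalSpace M] [ChartedSpace E M] [IsManifold 𝓘(ℝ, E) ∞ M]
  {F : Type*} [NormedAddCommGroup F] [NormedSpace ℝ F] [FiniteDimensional ℝ F]
  {S : Type*} [TopologicalSpace S] [ChartedSpace F S] [IsManifold 𝓘(ℝ, F) ∞ S]
  {g : LorentzianMetric E M} {ι : S → M}

theorem IsSpacelikeHypersurface.exists_isUnitNormal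
    (hι : IsSpacelikeHypersurface (F := F) g.form ι) (x : S) :
    ∃ ν, IsUnitNormal (F := F) g.form ι x ν :=
  exists_unit_normal (V := E) (W := F) (g.signature (ι x)) hι.codim_one (hι.spacelike x)

theorem LorentzianMetric.inChart_symm (g : LorentzianMetric E M) (x : M) (y u v : E) :
    inChart g.form x y u v = inChart g.form x y v u :=
  HasLorentzianSignature.symm (V := E) (g.signature _) _ _

/-- `toChart x` is a linear isomorphism and an isometry onto the coordinate form, so it carries a
signature basis to a signature basis. -/
theorem LorentzianMetric.hasLorentzianSignature_inChart (g : LorentzianMetric E M) (x : M) :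
    HasLorentzianSignature (inChart g.form x (extChartAt 𝓘(ℝ, E) x x)) := by
  obtain ⟨n, e, he⟩ := g.signature x
  have hinj : Function.Injective (toChart (E := E) x) := fun u v h ↦ by
    rw [← mfderiv_chart_symm_toChart x u, ← mfderiv_chart_symm_toChart x v, h]
  exact ⟨n, e.map (LinearEquiv.ofBijective (toChart (E := E) x).toLinearMap
    ⟨hinj, toChart_surjective x⟩), fun i j ↦ (inChart_toChart g.form x (e i) (e j)).trans (he i j)⟩

/-- The Hessian of the restriction of `f` to a spacelike hypersurface: it differs from the
restriction of the Hessian of `f` by `K(u, v) ∇_ν f`. -/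
theorem hessian_comp_apply (hι : IsSpacelikeHypersurface (F := F) g.form ι) {f : M → ℝ}
    (hf : ContMDiff 𝓘(ℝ, E) 𝓘(ℝ, ℝ) ∞ f) {x : S} {ν : TangentSpace 𝓘(ℝ, E) (ι x)}
    (hν : IsUnitNormal (F := F) g.form ι x ν) (u v : TangentSpace 𝓘(ℝ, F) x) :
    hessian (pullback (F := F) ι g.form) (f ∘ ι) x u v =
      pullback (F := F) ι (hessian g.form f) x u v +
      fderiv ℝ (f ∘ (extChartAt 𝓘(ℝ, E) (ι x)).symm) (extChartAt 𝓘(ℝ, E) (ι x) (ι x))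
        (toChart (ι x) ν) * extrinsicCurvature g.form ι x ν u v := by
  have hJ := contDiffAt_chart hι.smooth x
  have hf' := contDiffAt_comp_chart_symm hf (ι x)
  have hH := inChart_pullback hι.smooth g.form x
  have hu := comp_chart_symm_eventuallyEq (E := E) (F := F) hι.smooth.continuous f x
  have hG := differentiableAt_inChart g (ι x)
  have hsig := g.hasLorentzianSignature_inChart (ι x)
  have hA := toChart_mfderiv hι.smooth x
  have hGn : ∀ w, inChart g.form (ι x) _ (toChart (ι x) ν) (toChart (ι x) w) = _ :=
    inChart_toChart g.form (ι x) ν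
  have hpos : ∀ w : F, w ≠ 0 → 0 < inChart (pullback (F := F) ι g.form) x
      (extChartAt 𝓘(ℝ, F) x x) w w := fun w hw ↦ by
    obtain ⟨w, rfl⟩ := toChart_surjective x w
    rw [inChart_toChart]
    exact hι.spacelike x w fun h ↦ hw (by rw [h, map_zero])
  have hJx : (extChartAt 𝓘(ℝ, E) (ι x) ∘ ι ∘ (extChartAt 𝓘(ℝ, F) x).symm)
      (extChartAt 𝓘(ℝ, F) x x) = extChartAt 𝓘(ℝ, E) (ι x) (ι x) := by
    rw [Function.comp_apply, Function.comp_apply, extChartAt_to_inv]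
  simp only [pullback, hessian, extrinsicCurvature, pullForm_apply, hA]
  set a := extChartAt 𝓘(ℝ, F) x x
  set b := extChartAt 𝓘(ℝ, E) (ι x) (ι x)
  set J := extChartAt 𝓘(ℝ, E) (ι x) ∘ ι ∘ (extChartAt 𝓘(ℝ, F) x).symm
  set G := inChart g.form (ι x)
  set H := inChart (pullback (F := F) ι g.form) x
  set f' := f ∘ (extChartAt 𝓘(ℝ, E) (ι x)).symm
  set n := toChart (ι x) ν
  have hnA : ∀ w, G b n (fderiv ℝ J a w) = 0 := fun w ↦ by
    obtain ⟨w, rfl⟩ := toChart_surjective x w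
    rw [← hA, hGn]
    exact hν.2 w
  have hHa : H a = pullForm (G b) (fderiv ℝ J a) := by rw [hH.eq_of_nhds, hJx]
  have hHinv : (H a).IsInvertible := isInvertible_of_nondegenerate fun w hw ↦ by
    by_contra h0
    exact (hpos w h0).ne' (hw w)
  have hgauss := gauss_formula (by rwa [hJx]) (fun u v ↦ g.inChart_symm _ _ u v)
    (by rw [hJx]; exact isInvertible_of_nondegenerate fun _ ↦ hsig.nondegenerate) hJ hH hHinv
    (toChart x u) (toChart x v)
  rw [hJx] at hgauss
  -- The Gauss vector is `-G n (·)` times `n`. Its tangential part `A Γ_H` pairs to zero with `n`,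
  -- so the coefficient is exactly the extrinsic curvature; applying `df` then yields the correction
  -- term.
  have hnormal := eq_smul_normal_of_orthogonal hsig hι.codim_one (A := fderiv ℝ J a)
    (fun w hw ↦ by simpa [hHa, pullForm_apply] using hpos w hw)
    (by rw [hGn]; exact hν.1) hnA hgauss
  have hdf := congrArg (fderiv ℝ f' b) hnormal
  have hf'' := fderiv_fderiv_comp_apply (by rwa [hJx]) hJ (toChart x u) (toChart x v) (f := f')
  rw [hJx] at hf''
  have hu1 : fderiv ℝ ((f ∘ ι) ∘ (extChartAt 𝓘(ℝ, F) x).symm) a = fderiv ℝ f' b ∘L fderiv ℝ J a := by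
    rw [hu.fderiv_eq, fderiv_comp a (by rw [hJx]; exact hf'.differentiableAt (by norm_num))
      (hJ.differentiableAt (by norm_num)), hJx]
  have hu2 : fderiv ℝ (fderiv ℝ ((f ∘ ι) ∘ (extChartAt 𝓘(ℝ, F) x).symm)) a =
      fderiv ℝ (fderiv ℝ (f' ∘ J)) a := hu.fderiv.fderiv_eq
  simp only [map_add, map_sub, map_smul, hnA, smul_eq_mul] at hdf
  rw [hu1, hu2]
  simp [hf'']
  linear_combination hdf

/-- The Laplacian of the restriction of `f` to a spacelike hypersurface. -/
theorem laplacian_comp (hι : IsSpacelikeHypersurface (F := F) g.form ι) {f : M → ℝ}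
    (hf : ContMDiff 𝓘(ℝ, E) 𝓘(ℝ, ℝ) ∞ f) {x : S} {ν : TangentSpace 𝓘(ℝ, E) (ι x)}
    (hν : IsUnitNormal (F := F) g.form ι x ν) :
    laplacian (pullback (F := F) ι g.form) (f ∘ ι) x =
      metricTrace (pullback (F := F) ι g.form x) (pullback (F := F) ι (hessian g.form f) x) +
      fderiv ℝ (f ∘ (extChartAt 𝓘(ℝ, E) (ι x)).symm) (extChartAt 𝓘(ℝ, E) (ι x) (ι x))
        (toChart (ι x) ν) *
      metricTrace (pullback (F := F) ι g.form x) (extrinsicCurvature g.form ι x ν) := by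
  have h : hessian (pullback (F := F) ι g.form) (f ∘ ι) x =
      pullback (F := F) ι (hessian g.form f) x +
      fderiv ℝ (f ∘ (extChartAt 𝓘(ℝ, E) (ι x)).symm) (extChartAt 𝓘(ℝ, E) (ι x) (ι x))
        (toChart (ι x) ν) • extrinsicCurvature g.form ι x ν := by
    ext u v
    exact hessian_comp_apply hι hf hν u v
  rw [laplacian, h]
  exact metricTrace_add_smul (V := F) _ _ _ _

end Hypersurface

end SpacetimeConvex

theorem proposition4
    {E : Type*} [NormedAddCommGroup E] [NormedSpace ℝ E] [FiniteDimensional ℝ E]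
    {M : Type*} [TopologicalSpace M] [ChartedSpace E M] [IsManifold 𝓘(ℝ, E) ∞ M]
    {F : Type*} [NormedAddCommGroup F] [NormedSpace ℝ F] [FiniteDimensional ℝ F] [Nontrivial F]
    {S : Type*} [TopologicalSpace S] [ChartedSpace F S] [IsManifold 𝓘(ℝ, F) ∞ S]
    (g : SpacetimeConvex.LorentzianMetric E M)
    (f : M → ℝ) (hf : SpacetimeConvex.IsSpacetimeConvex g.form f)
    (ι : S → M)
    (hι : SpacetimeConvex.IsSpacelikeHypersurface (F := F) g.form ι)
    (hmax : SpacetimeConvex.IsMaximal (F := F) g.form ι) :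
    SpacetimeConvex.IsStrictlySubharmonic (SpacetimeConvex.pullback (F := F) ι g.form)
      (f ∘ ι) := by
  obtain ⟨c, hc, hconv⟩ := hf.convex
  refine ⟨hf.smooth.comp hι.smooth, fun x ↦ ?_⟩
  obtain ⟨ν, hν⟩ := hι.exists_isUnitNormal x
  rw [SpacetimeConvex.laplacian_comp hι hf.smooth hν, hmax x ν hν, mul_zero, add_zero]
  have h := SpacetimeConvex.le_metricTrace (V := F)
    (h := SpacetimeConvex.pullback (F := F) ι g.form x)
    (T := SpacetimeConvex.pullback (F := F) ι (SpacetimeConvex.hessian g.form f) x)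
    (fun u v ↦ SpacetimeConvex.HasLorentzianSignature.symm (V := E) (g.signature (ι x)) _ _)
    (hι.spacelike x) (c := c) (fun u ↦ hconv (ι x) _)
  -- Strictness comes from `dim F ≥ 1`: on a zero-dimensional hypersurface the trace would vanish.
  have hdim : (0 : ℝ) < Module.finrank ℝ F := by exact_mod_cast Module.finrank_pos
  exact (mul_pos hc hdim).trans_le h
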